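/- Let $p$ and $q$ be distinct primes, and let $p^*$ be the inverse of $p$ modulo $q$ with $1\le p^*\le q-1$. For a positive integer $n$, let $B_{+}(n)$ denote the maximum, and $-B_{-}(n)$ the minimum, among all coefficients $c_j$ ($0\le j\le \deg g$) of all monic divisors $g(x)=\sum_j c_jx^j\in\mathbb{Z}[x]$ of $x^n-1$. Then $$B_{-}(p^2q)=\min(p,p^*)+\min(p,q-p^*)\qquad\text{and}\qquad B_{+}(p^2q)=\min(p^2,q).$$ -/

import Mathlib

open Polynomial

/-- The set of coefficients `C(f) = {c_j : 0 ≤ j ≤ deg f}` of an integer polynomial `f`. -/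
def coeffSet (f : ℤ[X]) : Set ℤ :=
  {c | ∃ j : ℕ, j ≤ f.natDegree ∧ f.coeff j = c}

/-- The set of all coefficients of all monic divisors of `x ^ n - 1` in `ℤ[x]`. -/
def divisorCoeffs (n : ℕ) : Set ℤ :=
  {c | ∃ g : ℤ[X], g.Monic ∧ g ∣ X ^ n - 1 ∧ c ∈ coeffSet g}

/-- `B₊(n)`: the maximum of all coefficients of all monic divisors of `x ^ n - 1`. -/
noncomputable def Bplus (n : ℕ) : ℤ := sSup (divisorCoeffs n)

/-- `B₋(n)`: minus the minimum of all coefficients of all monic divisors of `x ^ n - 1`. -/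
noncomputable def Bminus (n : ℕ) : ℤ := -sInf (divisorCoeffs n)

/-! Write R = Φ_{pq} and s = p*. The monic divisors of X^{p²q} - 1 are the 64 subproducts of X - 1,
Φ_p, Φ_{p²} = Φ_p(X^p), Φ_q, R and Φ_{p²q} = R(X^p). Of the 32 without X - 1, all but three have
coefficients in [0, min(p, q)] or [-1, 1] (`coeffsIn_of_subproduct`); a factor X - 1 turns [a, b]
into [-(b - a), b - a], which still respects both claimed bounds.

The exception Φ_p Φ_{p²} Φ_q is a trapezoid of height min(p², q), the maximum. The exception Φ_p Φ_q
R(X^p) stays within the bounds, with or without X - 1. The exception Φ_{p²} R, times X - 1, gives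
the minimum: up to sign, the coefficients are second differences of F(wp + bq) = max(0, min(p, w +
1)), where 0 ≤ b < p (`intCoeff_staircase`). As ps = 1 + tq, a unit step of the index moves w by s
or q - s in absolute value, so a second difference is at most min(p, s) + min(p, q - s), with
equality at w = -1, b = p - 1. -/

/-- All coefficients of `f` lie in the interval `[a, b]`. -/
def CoeffsIn (a b : ℤ) (f : ℤ[X]) : Prop := ∀ k, a ≤ f.coeff k ∧ f.coeff k ≤ b

/-- The polynomial `1 + X + ⋯ + X ^ (k - 1)`. -/
noncomputable def geomPoly (k : ℕ) : ℤ[X] := ∑ i ∈ Finset.range k, X ^ i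

/-! ### Coefficient bounds under elementary operations -/

namespace CoeffsIn

theorem mono {a b c d : ℤ} {f : ℤ[X]} (h : CoeffsIn a b f) (hc : c ≤ a) (hd : b ≤ d) :
    CoeffsIn c d f := fun k => ⟨hc.trans (h k).1, (h k).2.trans hd⟩

theorem expand {a b : ℤ} {f : ℤ[X]} (h : CoeffsIn a b f) (ha : a ≤ 0) (hb : 0 ≤ b) {d : ℕ}
    (hd : 0 < d) : CoeffsIn a b (Polynomial.expand ℤ d f) := fun k => by
  rw [coeff_expand hd]
  split_ifs
  · exact h _
  · exact ⟨ha, hb⟩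

theorem X_pow_mul {a b : ℤ} {f : ℤ[X]} (h : CoeffsIn a b f) (ha : a ≤ 0) (hb : 0 ≤ b) (d : ℕ) :
    CoeffsIn a b (X ^ d * f) := fun k => by
  rw [coeff_X_pow_mul']
  split_ifs
  · exact h _
  · exact ⟨ha, hb⟩

theorem X_pow_sub_one_mul {a b : ℤ} {f : ℤ[X]} (h : CoeffsIn a b f) (ha : a ≤ 0) (hb : 0 ≤ b)
    (d : ℕ) : CoeffsIn (-(b - a)) (b - a) ((X ^ d - 1) * f) := fun k => by
  rw [sub_mul, one_mul, coeff_sub]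
  have h1 := h.X_pow_mul ha hb d k
  have h2 := h k
  constructor <;> linarith [h1.1, h1.2, h2.1, h2.2]

theorem X_sub_one_mul {a b : ℤ} {f : ℤ[X]} (h : CoeffsIn a b f) (ha : a ≤ 0) (hb : 0 ≤ b) :
    CoeffsIn (-(b - a)) (b - a) ((X - 1) * f) := by
  simpa using h.X_pow_sub_one_mul ha hb 1

theorem geomPoly (k : ℕ) : CoeffsIn 0 1 (geomPoly k) := fun j => by
  simp only [_root_.geomPoly, finsetSum_coeff, coeff_X_pow, Finset.sum_ite_eq]
  split_ifs <;> simp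

theorem sum {a b : ℤ} {k : ℕ} {f : ℕ → ℤ[X]} (h : ∀ i, CoeffsIn a b (f i)) :
    CoeffsIn (k * a) (k * b) (∑ i ∈ Finset.range k, f i) := fun j => by
  rw [finsetSum_coeff]
  constructor
  · simpa using Finset.card_nsmul_le_sum (Finset.range k) (fun i => (f i).coeff j) a
      (fun i _ => (h i j).1)
  · simpa using Finset.sum_le_card_nsmul (Finset.range k) (fun i => (f i).coeff j) b
      (fun i _ => (h i j).2)

theorem expand_geomPoly_mul {a b : ℤ} {f : ℤ[X]} (h : CoeffsIn a b f) (ha : a ≤ 0) (hb : 0 ≤ b)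
    (d k : ℕ) : CoeffsIn (k * a) (k * b) (Polynomial.expand ℤ d (_root_.geomPoly k) * f) := by
  rw [_root_.geomPoly, map_sum, Finset.sum_mul]
  refine sum fun i => ?_
  rw [map_pow, expand_X, ← pow_mul]
  exact h.X_pow_mul ha hb _

theorem geomPoly_mul {a b : ℤ} {f : ℤ[X]} (h : CoeffsIn a b f) (ha : a ≤ 0) (hb : 0 ≤ b)
    (k : ℕ) : CoeffsIn (k * a) (k * b) (_root_.geomPoly k * f) := by
  simpa using h.expand_geomPoly_mul ha hb 1 k

/-- Below degree dN, multiplication by X^{dN} - 1 only changes signs. This stands in for power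
series: a factor 1/(1 - X^d) becomes a long geometric sum. -/
theorem of_mul_X_pow_sub_one {a b : ℤ} {f : ℤ[X]} {d : ℕ} (hd : 0 < d)
    (h : ∀ N, CoeffsIn (-b) (-a) (f * (X ^ (d * N) - 1))) : CoeffsIn a b f := fun k => by
  have := h (k + 1) k
  have hk : ¬ d * (k + 1) ≤ k := by nlinarith
  rw [mul_sub, mul_one, coeff_sub, coeff_mul_X_pow', if_neg hk] at this
  constructor <;> linarith [this.1, this.2]

end CoeffsIn

/-! ### Products Φ_p(X^q) A(X^p) and indices wp + bq -/

/-- As q is invertible mod p, the residue of k singles out b, so only the summand X^{bq} A(X^p)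
reaches degree k. -/
theorem coeff_expand_geomPoly_mul_expand {p q : ℕ} (hp : 0 < p) (hpq : p.Coprime q) (A : ℤ[X])
    (k b : ℕ) (hb : b < p) (w : ℤ) (hk : (k : ℤ) = w * p + b * q) :
    (expand ℤ q (geomPoly p) * expand ℤ p A).coeff k =
      if 0 ≤ w then A.coeff w.toNat else 0 := by
  rw [geomPoly, map_sum, Finset.sum_mul, finsetSum_coeff, Finset.sum_eq_single b]
  · rw [map_pow, expand_X, ← pow_mul, coeff_X_pow_mul', coeff_expand hp]
    split_ifs with h1 h2 h3 h4 h5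
    · congr 1
      lift w to ℕ using h3
      have : k - q * b = w * p := by
        zify [h1]
        rw [hk]; ring
      rw [this, Nat.mul_div_cancel _ hp]; simp
    · exfalso
      push Not at h3
      have : (q * b : ℤ) ≤ k := by exact_mod_cast h1
      nlinarith
    · exfalso
      apply h2
      lift w to ℕ using h4
      have : k - q * b = w * p := by
        zify [h1]
        rw [hk]; ring
      rw [this]; exact Dvd.intro_left _ rfl
    · rfl
    · exfalso
      apply h1
      zify
      rw [hk]
      nlinarith
    · rfl
  · intro c hc hcb
    rw [map_pow, expand_X, ← pow_mul, coeff_X_pow_mul', coeff_expand hp]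
    split_ifs with h1 h2
    · exfalso
      apply hcb
      have h3 : (p : ℤ) ∣ (q : ℤ) * (b - c) := by
        have : (p : ℤ) ∣ ((k - q * c : ℕ) : ℤ) := by exact_mod_cast h2
        rw [Nat.cast_sub h1, hk] at this
        have h4 := (Int.dvd_add_right (Dvd.intro_left w rfl : (p : ℤ) ∣ w * p)).1
          (show (p : ℤ) ∣ w * p + q * (b - c) by convert this using 1; push_cast; ring)
        exact h4
      have h4 : (p : ℤ) ∣ (b : ℤ) - c :=
        (Nat.isCoprime_iff_coprime.2 hpq).dvd_of_dvd_mul_left h3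
      have hc' := Finset.mem_range.1 hc
      have h5 := Int.eq_zero_of_abs_lt_dvd h4 (by rw [abs_lt]; omega)
      omega
    · rfl
    · rfl
  · intro h
    exact absurd (Finset.mem_range.2 hb) h

theorem exists_eq_mul_add_mul {p q : ℕ} (hp : 0 < p) (hpq : p.Coprime q) (k : ℤ) :
    ∃ (w : ℤ) (b : ℕ), b < p ∧ k = w * p + b * q := by
  obtain ⟨u, v, huv⟩ := Nat.isCoprime_iff_coprime.2 hpq
  have hp' : (0 : ℤ) < p := by exact_mod_cast hp
  have h0 := Int.emod_nonneg (k * v) hp'.ne'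
  have h1 := Int.emod_lt_of_pos (k * v) hp'
  refine ⟨k * u + (k * v / p) * q, ((k * v) % p).toNat, by omega, ?_⟩
  rw [Int.toNat_of_nonneg h0]
  have h2 := Int.emod_add_mul_ediv (k * v) p
  have h3 : (k * v) % p = k * v - p * (k * v / p) := by linarith
  rw [h3]
  linear_combination -k * huv

theorem CoeffsIn.expand_geomPoly_mul_expand {p q : ℕ} (hp : 0 < p) (hpq : p.Coprime q) {a b : ℤ}
    (ha : a ≤ 0) (hb : 0 ≤ b) {A : ℤ[X]} (h : CoeffsIn a b A) :
    CoeffsIn a b (Polynomial.expand ℤ q (_root_.geomPoly p) * Polynomial.expand ℤ p A) := fun k => by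
  obtain ⟨w, c, hc, hk⟩ := exists_eq_mul_add_mul hp hpq (k : ℤ)
  rw [coeff_expand_geomPoly_mul_expand hp hpq A k c hc w hk]
  split_ifs
  · exact h _
  · exact ⟨ha, hb⟩

theorem CoeffsIn.geomPoly_mul_expand {p : ℕ} (hp : 0 < p) {a b : ℤ}
    (ha : a ≤ 0) (hb : 0 ≤ b) {A : ℤ[X]} (h : CoeffsIn a b A) :
    CoeffsIn a b (_root_.geomPoly p * Polynomial.expand ℤ p A) := by
  simpa using CoeffsIn.expand_geomPoly_mul_expand hp (Nat.coprime_one_right p) ha hb h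

/-- The shifts of f by multiples of d > deg f do not overlap. -/
theorem CoeffsIn.mul_expand_geomPoly {a b : ℤ} (ha : a ≤ 0) (hb : 0 ≤ b) {f : ℤ[X]}
    (h : CoeffsIn a b f) {d : ℕ} (hd : f.natDegree < d) (k : ℕ) :
    CoeffsIn a b (f * Polynomial.expand ℤ d (_root_.geomPoly k)) := fun j => by
  have hd0 : 0 < d := by omega
  rw [_root_.geomPoly, map_sum, Finset.mul_sum, finsetSum_coeff]
  have key : ∀ i, i ≠ j / d → (f * Polynomial.expand ℤ d (X ^ i)).coeff j = 0 := by
    intro i hi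
    rw [map_pow, expand_X, ← pow_mul, coeff_mul_X_pow']
    split_ifs with h1
    · apply coeff_eq_zero_of_natDegree_lt
      refine hd.trans_le ?_
      by_contra h2
      apply hi
      symm
      rw [Nat.div_eq_iff hd0]
      constructor
      · rw [mul_comm]; exact h1
      · rw [mul_comm]; omega
    · rfl
  by_cases hj : j / d ∈ Finset.range k
  · rw [Finset.sum_eq_single_of_mem _ hj (fun i _ hi => key i hi), map_pow, expand_X, ← pow_mul,
      coeff_mul_X_pow']
    split_ifs
    · exact h _
    · exact ⟨ha, hb⟩
  · rw [Finset.sum_eq_zero (fun i hi => key i (fun h => hj (h ▸ hi)))]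
    exact ⟨ha, hb⟩

/-! ### Identities between geometric sums and cyclotomic polynomials -/

theorem X_sub_one_mul_geomPoly (k : ℕ) : (X - 1) * geomPoly k = X ^ k - 1 := mul_geom_sum X k

theorem X_pow_sub_one_mul_expand_geomPoly (d k : ℕ) :
    (X ^ d - 1) * expand ℤ d (geomPoly k) = X ^ (d * k) - 1 := by
  have := congrArg (expand ℤ d) (X_sub_one_mul_geomPoly k)
  simpa [← pow_mul] using this

theorem geomPoly_mul_expand_geomPoly (m n : ℕ) :
    geomPoly m * expand ℤ m (geomPoly n) = geomPoly (m * n) := by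
  have h : (X - 1 : ℤ[X]) ≠ 0 := X_sub_C_ne_zero 1
  apply mul_left_cancel₀ h
  rw [← mul_assoc, X_sub_one_mul_geomPoly, X_pow_sub_one_mul_expand_geomPoly,
    X_sub_one_mul_geomPoly]

/-- Coefficients of the trapezoid `geomPoly p * geomPoly N` on its increasing part. -/
theorem coeff_geomPoly_mul_geomPoly {p N i : ℕ} (hi : i < N) :
    (geomPoly p * geomPoly N).coeff i = min (p : ℤ) (i + 1) := by
  have h : ∀ j, (X ^ j * geomPoly N).coeff i = if j ≤ i then 1 else 0 := by
    intro j
    rw [coeff_X_pow_mul']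
    split_ifs with h
    · simp only [geomPoly, finsetSum_coeff, coeff_X_pow, Finset.sum_ite_eq]
      rw [if_pos (Finset.mem_range.2 (by omega))]
    · rfl
  rw [geomPoly, Finset.sum_mul, finsetSum_coeff, Finset.sum_congr rfl (fun j _ => h j),
    Finset.sum_boole]
  have : {j ∈ Finset.range p | j ≤ i} = Finset.range (min p (i + 1)) := by
    ext j; simp
  rw [this, Finset.card_range]
  push_cast
  rfl

/-- The coefficient estimates use Φ_{pq} only through this relation, its mirror image in p and q,
and a degree bound; hence they are stated for a polynomial R. -/
theorem cyclotomic_mul_geomPoly {p q : ℕ} (hp : p.Prime) (hq : q.Prime) (hpq : p ≠ q) :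
    cyclotomic (p * q) ℤ * geomPoly q = expand ℤ p (geomPoly q) := by
  have := cyclotomic_expand_eq_cyclotomic_mul hp
    (fun h => hpq ((Nat.prime_dvd_prime_iff_eq hp hq).1 h)) ℤ
  rw [cyclotomic_prime ℤ (hp := ⟨hq⟩), mul_comm q p] at this
  exact this.symm

/-! ### The staircase and the divisor (X - 1) Φ_{p²} Φ_{pq} -/

/-- The coefficient of `f` at an integer index, zero at negative ones. -/
def intCoeff (f : ℤ[X]) (m : ℤ) : ℤ := if 0 ≤ m then f.coeff m.toNat else 0

/-- Integer indices spare the difference rule an exception at the constant term. -/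
theorem intCoeff_X_sub_one_mul (f : ℤ[X]) (m : ℤ) :
    intCoeff ((X - 1) * f) m = intCoeff f (m - 1) - intCoeff f m := by
  unfold intCoeff
  rcases lt_trichotomy m 0 with h | h | h
  · rw [if_neg (by omega), if_neg (by omega), if_neg (by omega), sub_zero]
  · subst h
    simp [sub_mul]
  · obtain ⟨n, rfl⟩ : ∃ n : ℕ, m = n + 1 := ⟨(m - 1).toNat, by omega⟩
    rw [if_pos (by omega), if_pos (by omega), if_pos (by omega)]
    have h1 : ((n : ℤ) + 1).toNat = n + 1 := by omega
    have h2 : ((n : ℤ) + 1 - 1).toNat = n := by omega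
    rw [h1, h2, sub_mul, one_mul, coeff_sub, coeff_X_mul]

theorem intCoeff_natCast (f : ℤ[X]) (k : ℕ) : intCoeff f k = f.coeff k := by
  simp [intCoeff]

theorem intCoeff_mul_X_pow_sub_one (f : ℤ[X]) {M k : ℕ} (h : k < M) :
    intCoeff (f * (X ^ M - 1)) k = -f.coeff k := by
  rw [intCoeff_natCast, mul_sub, mul_one, coeff_sub, coeff_mul_X_pow', if_neg (by omega), zero_sub]

/-- A truncation of the power series of `Φ_p(X ^ q) Φ_p(X ^ p) / (1 - X ^ p)`. -/
noncomputable def staircase (p q N : ℕ) : ℤ[X] :=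
  expand ℤ q (geomPoly p) * expand ℤ p (geomPoly p * geomPoly N)

/-- The coefficient is that of the trapezoid at w. The bound on m forces w < N, the increasing part;
the outer maximum covers w < 0. -/
theorem intCoeff_staircase {p q N : ℕ} (hp : 0 < p) (hpq : p.Coprime q) {m w b : ℤ}
    (hb : 0 ≤ b) (hbp : b < p) (hm : m = w * p + b * q) (hN : m < p * N) :
    intCoeff (staircase p q N) m = max 0 (min (p : ℤ) (w + 1)) := by
  have hp' : (0 : ℤ) < p := by exact_mod_cast hp
  lift b to ℕ using hb
  unfold intCoeff
  split_ifs with h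
  · lift m to ℕ using h
    rw [Int.toNat_natCast, staircase, coeff_expand_geomPoly_mul_expand hp hpq _ m b
      (by exact_mod_cast hbp) w hm]
    split_ifs with hw
    · lift w to ℕ using hw
      have hwN : w < N := by
        have h1 : (0 : ℤ) ≤ b * q := by positivity
        have h2 : (p : ℤ) * w < p * N := by linarith
        exact_mod_cast lt_of_mul_lt_mul_left h2 hp'.le
      rw [Int.toNat_natCast, coeff_geomPoly_mul_geomPoly hwN]
      omega
    · omega
  · have hw : w < 0 := by
      by_contra hw
      push Not at hw h
      have : (0 : ℤ) ≤ w * p + b * q := by positivity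
      omega
    omega

/-- Consecutive differences of the staircase coefficients. -/
theorem intCoeff_staircase_succ {p q N : ℕ} (hp : 0 < p) (hpq : p.Coprime q) {s t : ℤ}
    (ht : 0 ≤ t) (htp : t ≤ p) (hst : (p : ℤ) * s = 1 + t * q) {m w b : ℤ}
    (hb : 0 ≤ b) (hbp : b < p) (hm : m = w * p + b * q) (hN : m + 1 < p * N) :
    intCoeff (staircase p q N) (m + 1) =
      if t ≤ b then max 0 (min (p : ℤ) (w + s + 1)) else max 0 (min (p : ℤ) (w + s - q + 1)) := by
  split_ifs with h
  · exact intCoeff_staircase hp hpq (w := w + s) (b := b - t) (by omega) (by omega)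
      (by rw [hm]; linear_combination -hst) hN
  · exact intCoeff_staircase hp hpq (w := w + s - q) (b := b - t + p) (by omega) (by omega)
      (by rw [hm]; linear_combination -hst) hN

/-- Subtracting 1 = ps - tq replaces (w, b) by (w - s, b + t); if b + t ≥ p, trading p copies of q
for q copies of p brings b back into range. -/
theorem intCoeff_staircase_pred {p q N : ℕ} (hp : 0 < p) (hpq : p.Coprime q) {s t : ℤ}
    (ht : 0 ≤ t) (htp : t ≤ p) (hst : (p : ℤ) * s = 1 + t * q) {m w b : ℤ}
    (hb : 0 ≤ b) (hbp : b < p) (hm : m = w * p + b * q) (hN : m < p * N) :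
    intCoeff (staircase p q N) (m - 1) =
      if b + t < p then max 0 (min (p : ℤ) (w - s + 1))
      else max 0 (min (p : ℤ) (w - s + q + 1)) := by
  split_ifs with h
  · exact intCoeff_staircase hp hpq (w := w - s) (b := b + t) (by omega) (by omega)
      (by rw [hm]; linear_combination hst) (by omega)
  · exact intCoeff_staircase hp hpq (w := w - s + q) (b := b + t - p) (by omega) (by omega)
      (by rw [hm]; linear_combination hst) (by omega)

theorem staircase_eq {p q : ℕ} {R : ℤ[X]} (hR : R * geomPoly p = expand ℤ q (geomPoly p)) (N : ℕ) :
    expand ℤ p (geomPoly p) * R * (X ^ (p * N) - 1) = (X - 1) * staircase p q N := by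
  have h1 := X_pow_sub_one_mul_expand_geomPoly p N
  have h2 := X_sub_one_mul_geomPoly p
  rw [staircase, map_mul, ← hR, ← h1, ← h2]
  ring

section

variable {p q : ℕ} {R : ℤ[X]}

/-- The coefficients are differences of adjacent staircase values. These lie in [0, p] and differ by
at most max(s, q - s) ≤ q. -/
theorem coeffsIn_expand_geomPoly_mul (hp : 0 < p) (hpq : p.Coprime q) {s t : ℤ} (hs : 0 ≤ s)
    (hsq : s ≤ q) (ht : 0 ≤ t) (htp : t ≤ p) (hst : (p : ℤ) * s = 1 + t * q)
    (hR : R * geomPoly p = expand ℤ q (geomPoly p)) :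
    CoeffsIn (-min (p : ℤ) q) (min (p : ℤ) q) (expand ℤ p (geomPoly p) * R) := fun k => by
  have hM : k < p * (k + 1) := by nlinarith
  have h := intCoeff_mul_X_pow_sub_one (expand ℤ p (geomPoly p) * R) hM
  obtain ⟨w, b, hb, hk⟩ := exists_eq_mul_add_mul hp hpq (k : ℤ)
  have hM' : (k : ℤ) < p * (k + 1 : ℕ) := by exact_mod_cast hM
  rw [staircase_eq hR, intCoeff_X_sub_one_mul,
    intCoeff_staircase_pred hp hpq ht htp hst (by omega) (by omega) hk hM',
    intCoeff_staircase hp hpq (by omega) (by omega) hk hM'] at h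
  split_ifs at h <;> constructor <;> omega

theorem coeff_X_sub_one_mul_expand_geomPoly_mul
    (hR : R * geomPoly p = expand ℤ q (geomPoly p)) {k N : ℕ} (hN : k < p * N) :
    ((X - 1) * (expand ℤ p (geomPoly p) * R)).coeff k =
      2 * intCoeff (staircase p q N) (k - 1) - intCoeff (staircase p q N) (k - 1 + 1) -
        intCoeff (staircase p q N) (k - 1 - 1) := by
  have h := intCoeff_mul_X_pow_sub_one ((X - 1) * (expand ℤ p (geomPoly p) * R)) hN
  rw [mul_assoc, staircase_eq hR, intCoeff_X_sub_one_mul, intCoeff_X_sub_one_mul,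
    intCoeff_X_sub_one_mul] at h
  rw [sub_add_cancel]
  linarith

/-- If both neighbours shift w by the same amount in opposite directions, the two increments have
opposite signs; otherwise one is bounded by min(p, s) and the other by min(p, q - s). -/
theorem coeffsIn_X_sub_one_mul_expand_geomPoly_mul (hp : 0 < p) (hpq : p.Coprime q) {s t : ℤ}
    (hs : 0 ≤ s) (hsq : s ≤ q) (ht : 0 ≤ t) (htp : t ≤ p) (hst : (p : ℤ) * s = 1 + t * q)
    (hR : R * geomPoly p = expand ℤ q (geomPoly p)) :
    CoeffsIn (-(min (p : ℤ) s + min (p : ℤ) (q - s))) (min (p : ℤ) s + min (p : ℤ) (q - s))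
      ((X - 1) * (expand ℤ p (geomPoly p) * R)) := fun k => by
  have hM : k < p * (k + 1) := by nlinarith
  have hM' : (k : ℤ) < p * (k + 1 : ℕ) := by exact_mod_cast hM
  obtain ⟨w, b, hb, hk⟩ := exists_eq_mul_add_mul hp hpq ((k : ℤ) - 1)
  rw [coeff_X_sub_one_mul_expand_geomPoly_mul hR hM,
    intCoeff_staircase_pred hp hpq ht htp hst (by omega) (by omega) hk (by omega),
    intCoeff_staircase_succ hp hpq ht htp hst (by omega) (by omega) hk (by omega),
    intCoeff_staircase hp hpq (by omega) (by omega) hk (by omega)]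
  split_ifs <;> constructor <;> omega

theorem exists_coeff_X_sub_one_mul_expand_geomPoly_mul (hp : 2 ≤ p) (hq : 2 ≤ q)
    (hpq : p.Coprime q) {s t : ℤ}
    (hs : 0 ≤ s) (hsq : s ≤ q) (ht : 0 < t) (htp : t < p) (hst : (p : ℤ) * s = 1 + t * q)
    (hR : R * geomPoly p = expand ℤ q (geomPoly p)) :
    ∃ k, ((X - 1) * (expand ℤ p (geomPoly p) * R)).coeff k =
      -(min (p : ℤ) s + min (p : ℤ) (q - s)) := by
  have hp0 : 0 < p := by omega
  -- The centre (p - 1)q - p has w = -1 and b = p - 1. The staircase vanishes there, and both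
  -- neighbours wrap upwards, to min(p, s) and min(p, q - s).
  have hk0 : (0 : ℤ) ≤ (p - 1) * q - p := by
    have h1 : (2 : ℤ) ≤ p := by exact_mod_cast hp
    have h2 : (2 : ℤ) ≤ q := by exact_mod_cast hq
    nlinarith
  obtain ⟨K, hK⟩ := Int.eq_ofNat_of_zero_le hk0
  refine ⟨K + 1, ?_⟩
  have hM : K + 1 < p * (K + 2) := by nlinarith
  have hM' : ((K + 1 : ℕ) : ℤ) < p * (K + 2 : ℕ) := by exact_mod_cast hM
  have hk : ((K + 1 : ℕ) : ℤ) - 1 = (-1) * p + (p - 1) * q := by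
    push_cast; linarith
  rw [coeff_X_sub_one_mul_expand_geomPoly_mul hR hM,
    intCoeff_staircase_pred hp0 hpq ht.le htp.le hst (by omega) (by omega) hk (by omega),
    intCoeff_staircase_succ hp0 hpq ht.le htp.le hst (by omega) (by omega) hk (by omega),
    intCoeff_staircase hp0 hpq (by omega) (by omega) hk (by omega)]
  rw [if_pos (by omega), if_neg (by omega)]
  omega

end

/-! ### Monic divisors of products of primes -/

theorem Polynomial.Monic.eq_mul_of_dvd_prime_mul {g P Q : ℤ[X]} (hg : g.Monic) (hP : Prime P)
    (hPm : P.Monic) (h : g ∣ P * Q) :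
    ∃ u g', (u = 1 ∨ u = P) ∧ g'.Monic ∧ g' ∣ Q ∧ g = u * g' := by
  by_cases hd : P ∣ g
  · obtain ⟨g', rfl⟩ := hd
    exact ⟨P, g', Or.inr rfl, hPm.of_mul_monic_left hg,
      (mul_dvd_mul_iff_left hP.ne_zero).1 h, rfl⟩
  · refine ⟨1, g, Or.inl rfl, hg, ?_, (one_mul g).symm⟩
    obtain ⟨r, hr⟩ := h
    obtain ⟨r', rfl⟩ := (hP.dvd_or_dvd (show P ∣ g * r from ⟨Q, hr.symm⟩)).resolve_left hd
    exact ⟨r', mul_left_cancel₀ hP.ne_zero (by rw [hr]; ring)⟩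

theorem CoeffsIn.one : CoeffsIn 0 1 1 := by
  simpa [_root_.geomPoly] using CoeffsIn.geomPoly 1

theorem natDegree_geomPoly_lt {k : ℕ} (hk : 0 < k) : (geomPoly k).natDegree < k := by
  have : (geomPoly k).natDegree ≤ k - 1 := natDegree_sum_le_of_forall_le _ _ fun i hi => by
    have := Finset.mem_range.1 hi
    rw [natDegree_X_pow]
    omega
  omega

/-- `R (X ^ (p N) - 1)` in terms of `R (X ^ p - 1) = (X - 1) Φ_p(X ^ q)`. -/
theorem mul_X_pow_sub_one_eq {p q : ℕ} {R : ℤ[X]}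
    (hR : R * geomPoly p = expand ℤ q (geomPoly p)) (N : ℕ) :
    R * (X ^ (p * N) - 1) =
      (X - 1) * (expand ℤ q (geomPoly p) * expand ℤ p (geomPoly N)) := by
  linear_combination -R * X_pow_sub_one_mul_expand_geomPoly p N
    - R * expand ℤ p (geomPoly N) * X_sub_one_mul_geomPoly p
    + (X - 1) * expand ℤ p (geomPoly N) * hR

theorem expand_mul_X_pow_sub_one_eq {p q : ℕ} {R : ℤ[X]}
    (hR : R * geomPoly p = expand ℤ q (geomPoly p)) (N : ℕ) :
    expand ℤ p R * (X ^ (p * p * N) - 1) =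
      (X ^ p - 1) * expand ℤ p (expand ℤ q (geomPoly p) * expand ℤ p (geomPoly N)) := by
  simpa [← pow_mul, mul_assoc] using congrArg (expand ℤ p) (mul_X_pow_sub_one_eq hR N)

/-- R (X^{pN} - 1) is X - 1 times a polynomial with coefficients 0 and 1. Since p need not be prime,
p² can take its place. -/
theorem coeffsIn_neg_one_one {p q : ℕ} (hp : 0 < p) (hpq : p.Coprime q) {R : ℤ[X]}
    (hR : R * geomPoly p = expand ℤ q (geomPoly p)) : CoeffsIn (-1) 1 R := by
  refine CoeffsIn.of_mul_X_pow_sub_one hp fun N => ?_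
  rw [mul_X_pow_sub_one_eq hR]
  simpa using ((CoeffsIn.geomPoly N).expand_geomPoly_mul_expand hp hpq le_rfl
    zero_le_one).X_sub_one_mul le_rfl zero_le_one

theorem CoeffsIn.min_cast {a b : ℕ} {f : ℤ[X]} (ha : CoeffsIn 0 a f) (hb : CoeffsIn 0 b f) :
    CoeffsIn 0 (min (a : ℤ) b) f := fun k => ⟨(ha k).1, le_min (ha k).2 (hb k).2⟩

theorem CoeffsIn.geomPoly_mul_geomPoly (m n : ℕ) :
    CoeffsIn 0 (min (m : ℤ) n) (_root_.geomPoly m * _root_.geomPoly n) := by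
  apply CoeffsIn.min_cast
  · simpa using (CoeffsIn.geomPoly n).geomPoly_mul le_rfl zero_le_one m
  · simpa [mul_comm] using (CoeffsIn.geomPoly m).geomPoly_mul le_rfl zero_le_one n

/-! ### The 32 subproducts without X - 1 -/

section

variable {p q : ℕ} {R : ℤ[X]}

theorem coeffsIn_geomPoly_mul_expand (hp : 0 < p)
    (hpq : p.Coprime q) (hR : R * geomPoly p = expand ℤ q (geomPoly p)) :
    CoeffsIn (-1) 1 (geomPoly q * expand ℤ p R) := by
  refine CoeffsIn.of_mul_X_pow_sub_one (d := p * p) (by positivity) fun N => ?_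
  -- The relation (X^p - 1) Φ_q = (X^q - 1) Φ_p leaves a binomial times a polynomial with
  -- coefficients 0 and 1.
  have h : geomPoly q * expand ℤ p R * (X ^ (p * p * N) - 1) = (X ^ q - 1) *
      (geomPoly p * expand ℤ p (expand ℤ q (geomPoly p) * expand ℤ p (geomPoly N))) := by
    rw [mul_assoc, expand_mul_X_pow_sub_one_eq hR, ← X_sub_one_mul_geomPoly p,
      ← X_sub_one_mul_geomPoly q]
    ring
  rw [h]
  simpa using (((CoeffsIn.geomPoly N).expand_geomPoly_mul_expand hp hpq le_rfl
    zero_le_one).geomPoly_mul_expand hp le_rfl zero_le_one).X_pow_sub_one_mul le_rfl zero_le_one q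

theorem coeffsIn_expand_geomPoly_mul_expand (hp : 0 < p)
    (hpq : p.Coprime q) (hR : R * geomPoly p = expand ℤ q (geomPoly p)) :
    CoeffsIn (-1) 1 (expand ℤ q (geomPoly p) * expand ℤ p R) := by
  refine CoeffsIn.of_mul_X_pow_sub_one (d := p * p) (by positivity) fun N => ?_
  -- Φ_p(X^q) and Φ_p(X^{pq}) merge into the geometric sum of length p² in X^q.
  have h : expand ℤ q (geomPoly p) * expand ℤ p R * (X ^ (p * p * N) - 1) = (X ^ p - 1) *
      (expand ℤ q (geomPoly (p * p)) * expand ℤ (p * p) (geomPoly N)) := by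
    rw [mul_assoc, expand_mul_X_pow_sub_one_eq hR, ← geomPoly_mul_expand_geomPoly, map_mul,
      map_mul, expand_expand, expand_expand, expand_expand, mul_comm q p]
    ring
  rw [h]
  simpa using ((CoeffsIn.geomPoly N).expand_geomPoly_mul_expand (Nat.mul_pos hp hp)
    (hpq.mul_left hpq) le_rfl zero_le_one).X_pow_sub_one_mul le_rfl zero_le_one p

/-- The coefficients of the products of a subset of `Φ_p, Φ_{p²}, Φ_q, Φ_{pq}, Φ_{p²q}`,
apart from three exceptional subsets. -/
theorem coeffsIn_of_subproduct (hp : 2 ≤ p) (hq : 2 ≤ q) (hpq : p.Coprime q)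
    (hR : R * geomPoly p = expand ℤ q (geomPoly p))
    (hR' : R * geomPoly q = expand ℤ p (geomPoly q)) (hdeg : R.natDegree < p * q)
    {a b c r d : ℤ[X]} (ha : a = 1 ∨ a = geomPoly p) (hb : b = 1 ∨ b = expand ℤ p (geomPoly p))
    (hc : c = 1 ∨ c = geomPoly q) (hr : r = 1 ∨ r = R) (hd : d = 1 ∨ d = expand ℤ p R) :
    CoeffsIn 0 (min (p : ℤ) q) (a * b * c * r * d) ∨ CoeffsIn (-1) 1 (a * b * c * r * d) ∨
    a * b * c * r * d = expand ℤ p (geomPoly p) * R ∨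
    a * b * c * r * d = geomPoly q * (geomPoly p * expand ℤ p R) ∨
    a * b * c * r * d = geomPoly (p ^ 2) * geomPoly q := by
  have hp0 : 0 < p := by omega
  have hq0 : 0 < q := by omega
  have hpp : 0 < p * p := Nat.mul_pos hp0 hp0
  have hpq0 : 0 < p * q := Nat.mul_pos hp0 hq0
  have of01 : ∀ {f g : ℤ[X]} {P : Prop}, CoeffsIn 0 1 g → f = g →
      CoeffsIn 0 (min (p : ℤ) q) f ∨ P := by
    rintro f g P h rfl
    exact Or.inl (h.mono le_rfl (by omega))
  have ofm : ∀ {f g : ℤ[X]} {P : Prop}, CoeffsIn 0 (min (p : ℤ) q) g → f = g →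
      CoeffsIn 0 (min (p : ℤ) q) f ∨ P := by
    rintro f g P h rfl
    exact Or.inl h
  have ofpm : ∀ {f g : ℤ[X]} {P Q : Prop}, CoeffsIn (-1) 1 g → f = g →
      P ∨ CoeffsIn (-1) 1 f ∨ Q := by
    rintro f g P Q h rfl
    exact Or.inr (Or.inl h)
  have gp := CoeffsIn.geomPoly p
  have gq := CoeffsIn.geomPoly q
  have zo : (0 : ℤ) ≤ 1 := zero_le_one
  have mo : (-1 : ℤ) ≤ 0 := by norm_num
  have zz : (0 : ℤ) ≤ 0 := le_rfl
  have zm : (0 : ℤ) ≤ min (p : ℤ) q := by omega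
  have epq := expand_expand (R := ℤ) p q (geomPoly p)
  have epp := expand_expand (R := ℤ) p p (geomPoly q)
  have hD : expand ℤ p R * expand ℤ p (geomPoly p) = expand ℤ (p * q) (geomPoly p) := by
    rw [← map_mul, hR, epq]
  have hD' : expand ℤ p R * expand ℤ p (geomPoly q) = expand ℤ (p * p) (geomPoly q) := by
    rw [← map_mul, hR', epp]
  have hpp' := geomPoly_mul_expand_geomPoly p p
  have fR : CoeffsIn (-1) 1 R := coeffsIn_neg_one_one hp0 hpq hR
  -- R · R(X^p) satisfies the defining relation of R with p² in place of p.
  have fRD : CoeffsIn (-1) 1 (R * expand ℤ p R) := by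
    refine coeffsIn_neg_one_one hpp (hpq.mul_left hpq) ?_
    rw [← hpp', map_mul, expand_expand, mul_comm q p]
    linear_combination expand ℤ p R * expand ℤ p (geomPoly p) * hR
      + expand ℤ q (geomPoly p) * hD
  rcases ha with rfl | rfl <;> rcases hb with rfl | rfl <;> rcases hc with rfl | rfl <;>
    rcases hr with rfl | rfl <;> rcases hd with rfl | rfl <;> try simp only [one_mul, mul_one]
  · exact of01 CoeffsIn.one rfl
  · exact ofpm (fR.expand mo zo hp0) rfl
  · exact ofpm fR rfl
  · exact ofpm fRD rfl
  · exact of01 gq rfl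
  · exact ofpm (coeffsIn_geomPoly_mul_expand hp0 hpq hR) rfl
  · exact of01 (gq.expand zz zo hp0) (by rw [mul_comm, hR'])
  · exact of01 (gq.expand zz zo hpp) (by rw [mul_comm (geomPoly q), hR', mul_comm, hD'])
  · exact of01 (gp.expand zz zo hp0) rfl
  · exact of01 (gp.expand zz zo hpq0) (by rw [mul_comm, hD])
  · simp
  · exact ofpm (CoeffsIn.mul_expand_geomPoly mo zo fR hdeg p) (by rw [← hD]; ring)
  · refine ofm (CoeffsIn.min_cast ?_ ?_) rfl
    · simpa using gq.expand_geomPoly_mul zz zo p p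
    · simpa [mul_comm] using (gp.expand zz zo hp0).geomPoly_mul zz zo q
  · exact of01 (gq.mul_expand_geomPoly zz zo
      ((natDegree_geomPoly_lt hq0).trans_le (Nat.le_mul_of_pos_left q hp0)) p)
      (by rw [← hD]; ring)
  · exact ofm ((CoeffsIn.geomPoly_mul_geomPoly p q).expand zz zm hp0)
      (by rw [map_mul, ← hR']; ring)
  · exact of01 ((gq.geomPoly_mul_expand hp0 zz zo).expand zz zo hp0)
      (by rw [map_mul, epp, ← hD', ← hR']; ring)
  · exact of01 gp rfl
  · exact ofpm (fR.geomPoly_mul_expand hp0 mo zo) rfl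
  · exact of01 (gp.expand zz zo hq0) (by rw [mul_comm, hR])
  · exact ofpm (coeffsIn_expand_geomPoly_mul_expand hp0 hpq hR) (by rw [← hR]; ring)
  · exact ofm (CoeffsIn.geomPoly_mul_geomPoly p q) rfl
  · exact Or.inr (Or.inr (Or.inr (Or.inl (by ring))))
  · exact of01 (CoeffsIn.geomPoly (p * q))
      (by rw [← geomPoly_mul_expand_geomPoly, ← hR']; ring)
  · exact of01 ((gq.expand zz zo hp0).geomPoly_mul_expand hp0 zz zo)
      (by rw [epp, ← hD', ← hR']; ring)
  · exact of01 (CoeffsIn.geomPoly (p * p)) hpp'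
  · exact of01 ((gp.expand zz zo hq0).geomPoly_mul_expand hp0 zz zo)
      (by rw [epq, ← hD]; ring)
  · exact of01 (gp.expand_geomPoly_mul_expand hp0 hpq zz zo) (by rw [← hR]; ring)
  · exact of01 ((CoeffsIn.geomPoly (p * p)).expand zz zo hq0)
      (by rw [← hpp', map_mul, expand_expand, mul_comm q p, ← hD, ← hR]; ring)
  · exact Or.inr (Or.inr (Or.inr (Or.inr (by rw [hpp', sq]))))
  · refine ofm (CoeffsIn.mul_expand_geomPoly zz zm (CoeffsIn.geomPoly_mul_geomPoly p q)
      (d := p * q) ?_ p) (by rw [← hD]; ring)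
    have h1 := natDegree_geomPoly_lt hp0
    have h2 := natDegree_geomPoly_lt hq0
    have h3 := natDegree_mul_le (p := geomPoly p) (q := geomPoly q)
    nlinarith
  -- Two groupings, Φ_{p²} · (Φ_p Φ_q R) and (Φ_q R) · (Φ_p Φ_{p²}), give the bounds p and q.
  · refine ofm (CoeffsIn.min_cast ?_ ?_) rfl
    · have := (CoeffsIn.geomPoly (p * q)).expand_geomPoly_mul zz zo p p
      rw [← geomPoly_mul_expand_geomPoly, ← hR'] at this
      convert this using 1 <;> ring
    · have := (CoeffsIn.geomPoly (p * p)).expand_geomPoly_mul zz zo p q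
      rw [← geomPoly_mul_expand_geomPoly, ← hR'] at this
      convert this using 1 <;> ring
  · refine of01 (CoeffsIn.geomPoly (p * p * q)) ?_
    rw [← geomPoly_mul_expand_geomPoly, ← hD', ← hR', ← hpp']
    ring

end

theorem Polynomial.Monic.exists_eq_prod_of_dvd {g : ℤ[X]} {P₁ P₂ P₃ P₄ P₅ P₆ : ℤ[X]}
    (hg : g.Monic) (h : ∀ P ∈ [P₁, P₂, P₃, P₄, P₅, P₆], Prime P ∧ P.Monic)
    (hd : g ∣ P₁ * (P₂ * (P₃ * (P₄ * (P₅ * P₆))))) :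
    ∃ u₁ u₂ u₃ u₄ u₅ u₆ : ℤ[X], (u₁ = 1 ∨ u₁ = P₁) ∧ (u₂ = 1 ∨ u₂ = P₂) ∧ (u₃ = 1 ∨ u₃ = P₃) ∧
      (u₄ = 1 ∨ u₄ = P₄) ∧ (u₅ = 1 ∨ u₅ = P₅) ∧ (u₆ = 1 ∨ u₆ = P₆) ∧
      g = u₁ * (u₂ * u₃ * u₄ * u₅ * u₆) := by
  obtain ⟨h₁, h₂, h₃, h₄, h₅, h₆⟩ : (Prime P₁ ∧ P₁.Monic) ∧ (Prime P₂ ∧ P₂.Monic) ∧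
      (Prime P₃ ∧ P₃.Monic) ∧ (Prime P₄ ∧ P₄.Monic) ∧ (Prime P₅ ∧ P₅.Monic) ∧
      (Prime P₆ ∧ P₆.Monic) := by simpa using h
  rw [← mul_one P₆] at hd
  obtain ⟨u₁, g₁, hu₁, hg₁, hd₁, rfl⟩ := hg.eq_mul_of_dvd_prime_mul h₁.1 h₁.2 hd
  obtain ⟨u₂, g₂, hu₂, hg₂, hd₂, rfl⟩ := hg₁.eq_mul_of_dvd_prime_mul h₂.1 h₂.2 hd₁
  obtain ⟨u₃, g₃, hu₃, hg₃, hd₃, rfl⟩ := hg₂.eq_mul_of_dvd_prime_mul h₃.1 h₃.2 hd₂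
  obtain ⟨u₄, g₄, hu₄, hg₄, hd₄, rfl⟩ := hg₃.eq_mul_of_dvd_prime_mul h₄.1 h₄.2 hd₃
  obtain ⟨u₅, g₅, hu₅, hg₅, hd₅, rfl⟩ := hg₄.eq_mul_of_dvd_prime_mul h₅.1 h₅.2 hd₄
  obtain ⟨u₆, g₆, hu₆, hg₆, hd₆, rfl⟩ := hg₅.eq_mul_of_dvd_prime_mul h₆.1 h₆.2 hd₅
  have : g₆ = 1 := hg₆.isUnit_iff.1 (isUnit_of_dvd_one hd₆)
  subst this
  exact ⟨u₁, u₂, u₃, u₄, u₅, u₆, hu₁, hu₂, hu₃, hu₄, hu₅, hu₆, by ring⟩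

/-! ### The factorization of X^{p²q} - 1 and the extreme coefficients -/

theorem cyclotomic_eq_geomPoly {p : ℕ} (hp : p.Prime) : cyclotomic p ℤ = geomPoly p :=
  cyclotomic_prime ℤ (hp := ⟨hp⟩)

theorem cyclotomic_sq_of_prime {p : ℕ} (hp : p.Prime) :
    cyclotomic (p ^ 2) ℤ = expand ℤ p (geomPoly p) := by
  have := cyclotomic_expand_eq_cyclotomic hp dvd_rfl ℤ
  rw [cyclotomic_eq_geomPoly hp, ← sq] at this
  exact this.symm

theorem cyclotomic_sq_mul {p q : ℕ} (hp : p.Prime) :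
    cyclotomic (p ^ 2 * q) ℤ = expand ℤ p (cyclotomic (p * q) ℤ) := by
  rw [cyclotomic_expand_eq_cyclotomic hp (dvd_mul_right p q)]
  congr 1
  ring

theorem mem_divisorCoeffs_of_ne_zero {n k : ℕ} {g : ℤ[X]} (hg : g.Monic) (hd : g ∣ X ^ n - 1)
    (h : g.coeff k ≠ 0) : g.coeff k ∈ divisorCoeffs n :=
  ⟨g, hg, hd, k, le_natDegree_of_ne_zero h, rfl⟩

section

variable {p q : ℕ}

theorem X_pow_sub_one_eq_cyclotomic_mul (hp : p.Prime) (hq : q.Prime) (hpq : p ≠ q) :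
    (X ^ (p ^ 2 * q) - 1 : ℤ[X]) = (X - 1) * (geomPoly p * (expand ℤ p (geomPoly p) *
      (geomPoly q * (cyclotomic (p * q) ℤ * expand ℤ p (cyclotomic (p * q) ℤ))))) := by
  have h1 := geomPoly_mul_expand_geomPoly (p ^ 2) q
  have h2 := geomPoly_mul_expand_geomPoly p p
  have h3 := cyclotomic_mul_geomPoly hp hq hpq
  have h4 := congrArg (expand ℤ p) h3
  rw [map_mul, expand_expand, ← sq] at h4
  rw [← X_sub_one_mul_geomPoly, ← h1, ← h4, ← h3, sq, ← h2]
  ring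

/-- The coefficients of an arbitrary monic divisor of `X ^ (p ^ 2 * q) - 1`. -/
theorem coeffsIn_of_monic_of_dvd (hp : p.Prime) (hq : q.Prime) (hpq : p ≠ q) {s t : ℤ}
    (hs : 0 < s) (hsq : s < q) (ht : 0 < t) (htp : t < p) (hst : (p : ℤ) * s = 1 + t * q)
    {g : ℤ[X]} (hg : g.Monic) (hd : g ∣ X ^ (p ^ 2 * q) - 1) :
    CoeffsIn (-(min (p : ℤ) s + min (p : ℤ) (q - s))) (min ((p : ℤ) ^ 2) q) g := by
  have hp2 := hp.two_le
  have hq2 := hq.two_le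
  have hcop := (Nat.coprime_primes hp hq).2 hpq
  have hprime : ∀ n, 0 < n → Prime (cyclotomic n ℤ) ∧ (cyclotomic n ℤ).Monic := fun n hn =>
    ⟨(cyclotomic.irreducible hn).prime, cyclotomic.monic n ℤ⟩
  have hR' := cyclotomic_mul_geomPoly hp hq hpq
  have hR := cyclotomic_mul_geomPoly hq hp hpq.symm
  rw [mul_comm q p] at hR
  have hdeg : (cyclotomic (p * q) ℤ).natDegree < p * q := by
    rw [natDegree_cyclotomic]
    exact Nat.totient_lt _ (by nlinarith)
  rw [X_pow_sub_one_eq_cyclotomic_mul hp hq hpq] at hd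
  -- Needed for min(p, s) + min(p, q - s) ≤ min(p², q), the upper bound for (X - 1) Φ_{p²} R.
  have hpsq : (2 * p : ℤ) ≤ p ^ 2 := by
    have : (2 : ℤ) ≤ p := by exact_mod_cast hp2
    nlinarith
  obtain ⟨u, a, b, c, r, d, hu, ha, hb, hc, hr, he, rfl⟩ := hg.exists_eq_prod_of_dvd (by
    intro P hP
    simp only [List.mem_cons, List.not_mem_nil, or_false] at hP
    rcases hP with rfl | rfl | rfl | rfl | rfl | rfl
    · simpa using hprime 1 one_pos
    · simpa [cyclotomic_eq_geomPoly hp] using hprime p hp.pos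
    · simpa [cyclotomic_sq_of_prime hp] using hprime (p ^ 2) (pow_pos hp.pos 2)
    · simpa [cyclotomic_eq_geomPoly hq] using hprime q hq.pos
    · exact hprime _ (Nat.mul_pos hp.pos hq.pos)
    · rw [← cyclotomic_sq_mul hp]
      exact hprime _ (Nat.mul_pos (pow_pos hp.pos 2) hq.pos)) hd
  have zo : (0 : ℤ) ≤ 1 := zero_le_one
  have mo : (-1 : ℤ) ≤ 0 := by norm_num
  have zm : (0 : ℤ) ≤ min (p : ℤ) q := by omega
  rcases coeffsIn_of_subproduct hp2 hq2 hcop hR hR' hdeg ha hb hc hr he with h | h | h | h | h <;>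
    rcases hu with rfl | rfl <;> try rw [one_mul]
  · exact h.mono (by omega) (by omega)
  · exact (h.X_sub_one_mul le_rfl zm).mono (by omega) (by omega)
  · exact h.mono (by omega) (by omega)
  · exact (h.X_sub_one_mul mo zo).mono (by omega) (by omega)
  · rw [h]
    exact (coeffsIn_expand_geomPoly_mul hp.pos hcop hs.le hsq.le ht.le htp.le hst hR).mono
      (by omega) (by omega)
  · rw [h]
    exact (coeffsIn_X_sub_one_mul_expand_geomPoly_mul hp.pos hcop hs.le hsq.le ht.le htp.le
      hst hR).mono (by omega) (by omega)
  · rw [h]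
    -- Splitting off Φ_q or Φ_p from Φ_p Φ_q R(X^p) leaves coefficients in [-1, 1], whence the
    -- bounds q and p.
    have h1 := ((coeffsIn_neg_one_one hp.pos hcop hR).geomPoly_mul_expand hp.pos mo
      zo).geomPoly_mul mo zo q
    have h2 := (coeffsIn_geomPoly_mul_expand hp.pos hcop hR).geomPoly_mul mo zo p
    rw [mul_left_comm] at h2
    intro k
    have h3 := h1 k
    have h4 := h2 k
    constructor <;> omega
  · rw [h, mul_left_comm (geomPoly q), ← mul_assoc, X_sub_one_mul_geomPoly]
    exact ((coeffsIn_geomPoly_mul_expand hp.pos hcop hR).X_pow_sub_one_mul mo zo p).mono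
      (by omega) (by omega)
  · rw [h]
    exact (CoeffsIn.geomPoly_mul_geomPoly (p ^ 2) q).mono (by omega) (by push_cast; rfl)
  · rw [h, ← mul_assoc, X_sub_one_mul_geomPoly]
    exact ((CoeffsIn.geomPoly q).X_pow_sub_one_mul le_rfl zo _).mono (by omega) (by omega)

theorem isLeast_divisorCoeffs (hp : p.Prime) (hq : q.Prime) (hpq : p ≠ q) {s t : ℤ}
    (hs : 0 < s) (hsq : s < q) (ht : 0 < t) (htp : t < p) (hst : (p : ℤ) * s = 1 + t * q) :
    IsLeast (divisorCoeffs (p ^ 2 * q)) (-(min (p : ℤ) s + min (p : ℤ) (q - s))) := by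
  have hp2 := hp.two_le
  have hcop := (Nat.coprime_primes hp hq).2 hpq
  constructor
  · have hR := cyclotomic_mul_geomPoly hq hp hpq.symm
    rw [mul_comm q p] at hR
    obtain ⟨k, hk⟩ := exists_coeff_X_sub_one_mul_expand_geomPoly_mul hp2 hq.two_le hcop hs.le
      hsq.le ht htp hst hR
    rw [← hk]
    refine mem_divisorCoeffs_of_ne_zero ?_ ?_ (by rw [hk]; omega)
    · refine (monic_X_sub_C 1).mul (Monic.mul ?_ (cyclotomic.monic _ _))
      rw [← cyclotomic_sq_of_prime hp]
      exact cyclotomic.monic _ _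
    · rw [X_pow_sub_one_eq_cyclotomic_mul hp hq hpq]
      exact ⟨geomPoly p * (geomPoly q * expand ℤ p (cyclotomic (p * q) ℤ)), by ring⟩
  · rintro c ⟨g, hg, hd, k, -, rfl⟩
    exact (coeffsIn_of_monic_of_dvd hp hq hpq hs hsq ht htp hst hg hd k).1

theorem isGreatest_divisorCoeffs (hp : p.Prime) (hq : q.Prime) (hpq : p ≠ q) {s t : ℤ}
    (hs : 0 < s) (hsq : s < q) (ht : 0 < t) (htp : t < p) (hst : (p : ℤ) * s = 1 + t * q) :
    IsGreatest (divisorCoeffs (p ^ 2 * q)) (min ((p : ℤ) ^ 2) q) := by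
  have hp2 : 0 < p ^ 2 := pow_pos hp.pos 2
  have hq0 := hq.pos
  constructor
  -- The index min(p², q) - 1 is where the trapezoid first reaches its plateau.
  · have hk : (geomPoly (p ^ 2) * geomPoly q).coeff (min (p ^ 2) q - 1) = min ((p : ℤ) ^ 2) q := by
      rw [coeff_geomPoly_mul_geomPoly (by omega)]
      push_cast [show 1 ≤ min (p ^ 2) q by omega]
      simp
    rw [← hk]
    refine mem_divisorCoeffs_of_ne_zero ?_ ?_ ?_
    · refine Monic.mul ?_ ?_
      · rw [sq, ← geomPoly_mul_expand_geomPoly, ← cyclotomic_sq_of_prime hp]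
        refine Monic.mul ?_ (cyclotomic.monic _ _)
        rw [← cyclotomic_eq_geomPoly hp]
        exact cyclotomic.monic _ _
      · rw [← cyclotomic_eq_geomPoly hq]
        exact cyclotomic.monic _ _
    · rw [X_pow_sub_one_eq_cyclotomic_mul hp hq hpq, sq, ← geomPoly_mul_expand_geomPoly]
      exact ⟨(X - 1) * (cyclotomic (p * q) ℤ * expand ℤ p (cyclotomic (p * q) ℤ)), by ring⟩
    · rw [hk]
      have : (0 : ℤ) < (p : ℤ) ^ 2 := by exact_mod_cast hp2
      omega
  · rintro c ⟨g, hg, hd, k, -, rfl⟩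
    exact (coeffsIn_of_monic_of_dvd hp hq hpq hs hsq ht htp hst hg hd k).2

end

theorem mainTheorem2 (p q : ℕ) (hp : p.Prime) (hq : q.Prime) (hpq : p ≠ q)
    (pstar : ℕ) (hpstar_pos : 1 ≤ pstar) (hpstar_lt : pstar ≤ q - 1)
    (hpstar_inv : p * pstar ≡ 1 [MOD q]) :
    (IsLeast (divisorCoeffs (p ^ 2 * q)) (-Bminus (p ^ 2 * q)) ∧
      Bminus (p ^ 2 * q) = min (p : ℤ) (pstar : ℤ) + min (p : ℤ) ((q : ℤ) - (pstar : ℤ))) ∧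
    (IsGreatest (divisorCoeffs (p ^ 2 * q)) (Bplus (p ^ 2 * q)) ∧
      Bplus (p ^ 2 * q) = min ((p : ℤ) ^ 2) (q : ℤ)) := by
  have hp2 : (2 : ℤ) ≤ p := by exact_mod_cast hp.two_le
  have hq2 := hq.two_le
  have hs : (1 : ℤ) ≤ pstar := by exact_mod_cast hpstar_pos
  have hsq : (pstar : ℤ) ≤ q - 1 := by omega
  obtain ⟨t, ht⟩ := (Nat.modEq_iff_dvd.1 hpstar_inv.symm)
  push_cast at ht
  have hst : (p : ℤ) * pstar = 1 + t * q := by linarith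
  -- Positivity comes from p · p* > 1, and t < p from p* < q.
  have ht0 : 0 < t := by
    by_contra h
    nlinarith
  have htp : t < p := by
    by_contra h
    nlinarith
  have hL := isLeast_divisorCoeffs hp hq hpq (s := pstar) (by omega) (by omega) ht0 htp hst
  have hG := isGreatest_divisorCoeffs hp hq hpq (s := pstar) (by omega) (by omega) ht0 htp hst
  have hB : Bminus (p ^ 2 * q) = min (p : ℤ) pstar + min (p : ℤ) (q - pstar) := by
    rw [Bminus, hL.csInf_eq, neg_neg]
  have hB' : Bplus (p ^ 2 * q) = min ((p : ℤ) ^ 2) q := hG.csSup_eq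
  exact ⟨⟨by rwa [hB], hB⟩, by rwa [hB'], hB'⟩
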